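/- **Codes.** A network is a finite directed acyclic multigraph together with finitely many messages, each originating at a node, and a set of demanded messages for each node (a receiver is a node with at least one demand). For positive integers $k,n$, a $(k,n)$ code over an alphabet $\mathcal A$ (a finite set with $|\mathcal A|\ge 2$) takes each message to be a vector in $\mathcal A^k$, and assigns to each edge an edge function, which computes the vector in $\mathcal A^n$ carried by the edge from the messages originating at its tail and the vectors carried by the in-edges of its tail, and to each demand of each receiver a decoding function, which maps the inputs of the receiver (the messages originating there and the vectors on its in-edges) to $\mathcal A^k$. It is a $(k,n)$ solution if for all values of the messages every decoding function returns the demanded message. Over a field alphabet $\mathbb F$ the code is linear if every edge function and every decoding function is of the form $\sum_i M_i x_i+\sum_j M'_j y_j$ for matrices $M_i,M'_j$ over $\mathbb F$, where $x_i$ are the message inputs and $y_j$ the in-edge vectors. The capacity of a network is $\sup\{k/n\}$ over all $(k,n)$ solutions over some alphabet; its linear capacity over $\mathbb F$ is $\sup\{k/n\}$ over all $(k,n)$ linear solutions over $\mathbb F$. **The network $\mathcal N_3(m_1,m_2)$.** Let $m_1,m_2\ge 2$. There are a source node $S_z$ generating the message $z$ and, for $l=1,2$ and $1\le j\le m_l$,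 a source node $S^{(l)}_j$ generating the message $x^{(l)}_j$. Put $x^{(l)}_0=z$ and $S^{(l)}_0=S_z$. For each $l=1,2$ there is a block with nodes $u^{(l)},v^{(l)}$ and $u^{(l)}_i,v^{(l)}_i,R^{(l)}_i$ $(0\le i\le m_l)$ and with edges $S^{(l)}_j\to u^{(l)}_i$ $(j\ne i)$, $S^{(l)}_j\to u^{(l)}$, $u^{(l)}_i\to v^{(l)}_i$, $u^{(l)}\to v^{(l)}$, $v^{(l)}_i\to R^{(l)}_i$, $v^{(l)}\to R^{(l)}_i$ for $0\le i,j\le m_l$; the receiver $R^{(l)}_i$ demands $x^{(l)}_i$. One further receiver $R_z$ has an in-edge from every $v^{(l)}_i$ $(l=1,2,\ 0\le i\le m_l)$ and demands $z$. **Lemma.** For all integers $m_1,m_2\ge 2$, the network $\mathcal N_3(m_1,m_2)$ has (a) capacity equal to $1$; (b) linear capacity equal to $1$ over every finite field whose characteristic is relatively prime to $m_1$ or to $m_2$; (c) linear capacity equal to $1-\frac{1}{2m_1+2m_2+3}$ over every finite field whose characteristic divides both $m_1$ and $m_2$; moreover, over every such field there is a $(2m_1+2m_2+2,\;2m_1+2m_2+3)$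 linear solution, so the supremum is attained. -/

import Mathlib

namespace NetworkCoding

/-- A network on a node set `V`, with edge set `E` and set of message vectors `M`: a directed
acyclic multigraph (finite once `V`, `E`, `M` are), together with the node at which each message
vector originates and the set of messages that each node demands.  The sources are the nodes of the
form `origin w`; the receivers are the nodes with a nonempty set of demands. -/
structure Network (V E M : Type) where
  tail : E → V
  head : E → V
  acyclic : ∀ v : V, ¬ Relation.TransGen (fun a b : V => ∃ e : E, tail e = a ∧ head e = b) v v
  origin : M → V
  demands : V → Set M

namespace Network

variable {V E M : Type} (N : Network V E M)

/-- What node `v` sees: a vector in `A ^ k` for each message originating at `v` and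
a vector in `A ^ n` for each edge that enters `v`. -/
abbrev Inputs (A : Type*) (k n : ℕ) (v : V) : Type _ :=
  ({w : M // N.origin w = v} → Fin k → A) × ({e : E // N.head e = v} → Fin n → A)

/-- The inputs of node `v` when the messages are `x` and the edges carry `y`. -/
def inputs {A : Type*} {k n : ℕ} (x : M → Fin k → A) (y : E → Fin n → A) (v : V) :
    N.Inputs A k n v :=
  (fun w => x w, fun e => y e)

/-- A `(k, n)` fractional code over the alphabet `A`: an edge function for every edge
and a decoding function for every demand of every node. -/
structure Code (A : Type*) (k n : ℕ) where
  edgeFn : ∀ e : E, N.Inputs A k n (N.tail e) → Fin n → A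
  decode : ∀ v : V, N.demands v → N.Inputs A k n v → Fin k → A

variable {N}

/-- Under the code `C` and the messages `x`, the vectors carried by the edges are `y`. -/
def Code.Carries {A : Type*} {k n : ℕ} (C : N.Code A k n)
    (x : M → Fin k → A) (y : E → Fin n → A) : Prop :=
  ∀ e : E, y e = C.edgeFn e (N.inputs x y (N.tail e))

/-- In a finite network, the messages determine the vectors carried by the edges. -/
theorem Code.existsUnique_carries [Finite E] {A : Type*} {k n : ℕ} (C : N.Code A k n)
    (x : M → Fin k → A) : ∃! y : E → Fin n → A, C.Carries x y := by
  let r : E → E → Prop := fun e' e => N.head e' = N.tail e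
  have hirr : ∀ e, ¬ Relation.TransGen r e e := fun e h =>
    N.acyclic (N.tail e) (h.lift N.tail fun a b hab => ⟨a, rfl, hab⟩)
  have : IsTrans E (Relation.TransGen r) := ⟨fun _ _ _ => Relation.TransGen.trans⟩
  have : Std.Irrefl (Relation.TransGen r) := ⟨hirr⟩
  have wf : WellFounded r :=
    Subrelation.wf (fun h => Relation.TransGen.single h)
      (Finite.wellFounded_of_trans_of_irrefl (Relation.TransGen r))
  let F : ∀ e : E, (∀ e', r e' e → Fin n → A) → Fin n → A := fun e ih =>
    C.edgeFn e (fun w => x w, fun e' => ih e'.1 e'.2)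
  refine ⟨wf.fix F, fun e => wf.fix_eq F e, fun y hy => ?_⟩
  funext e
  induction e using wf.induction with
  | _ e ih =>
    rw [hy e, wf.fix_eq F e]
    have h : (fun e' : {e' : E // N.head e' = N.tail e} => y e'.1)
        = fun e' => wf.fix F e'.1 := funext fun e' => ih e'.1 e'.2
    change C.edgeFn e (_, fun e' => y e'.1) = C.edgeFn e (_, fun e' => wf.fix F e'.1)
    rw [h]

/-- The code is a solution: whatever the messages are, every decoding function recovers
the demanded message vector. -/
def Code.IsSolution {A : Type*} {k n : ℕ} (C : N.Code A k n) : Prop :=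
  ∀ (x : M → Fin k → A) (y : E → Fin n → A), C.Carries x y →
    ∀ (v : V) (w : N.demands v), C.decode v w (N.inputs x y v) = x w

/-- A function of the inputs of a node is linear over the `R`-module `A` if it has the form
`(x, y) ↦ ∑ M_w x_w + ∑ M'_e y_e` for matrices `M_w`, `M'_e` with entries in `R`. -/
def IsLinearFn [DecidableEq V] [Fintype E] [Fintype M] (R : Type*) {A : Type*} [Ring R]
    [AddCommGroup A] [Module R A] {k n d : ℕ} {v : V}
    (f : N.Inputs A k n v → Fin d → A) : Prop :=
  ∃ (P : {w : M // N.origin w = v} → Matrix (Fin d) (Fin k) R)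
    (Q : {e : E // N.head e = v} → Matrix (Fin d) (Fin n) R),
    ∀ (a : N.Inputs A k n v) (i : Fin d),
      f a i = ∑ w, ∑ j, P w i j • a.1 w j + ∑ e, ∑ j, Q e i j • a.2 e j

/-- A code is linear if all its edge functions and decoding functions are. -/
def Code.IsLinear [DecidableEq V] [Fintype E] [Fintype M] (R : Type*) {A : Type*} [Ring R]
    [AddCommGroup A] [Module R A] {k n : ℕ} (C : N.Code A k n) : Prop :=
  (∀ e : E, IsLinearFn R (C.edgeFn e)) ∧
    ∀ (v : V) (w : N.demands v), IsLinearFn R (C.decode v w)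

variable (N)

/-- There is a `(k, n)` solution over the alphabet `A`. -/
def HasSolution (A : Type*) (k n : ℕ) : Prop :=
  ∃ C : N.Code A k n, C.IsSolution

/-- There is a `(k, n)` linear solution over the `R`-module `A`. -/
def HasLinearSolution [DecidableEq V] [Fintype E] [Fintype M] (R A : Type*) [Ring R]
    [AddCommGroup A] [Module R A] (k n : ℕ) : Prop :=
  ∃ C : N.Code A k n, C.IsSolution ∧ C.IsLinear R

/-- The capacity: the supremum of `k / n` over all `(k, n)` solutions over some finite alphabet
with at least two symbols.  It is taken in the extended reals, where every set has a supremum.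
(As alphabets are finite, those in `Type` represent all of them.) -/
noncomputable def capacity : EReal :=
  sSup {r : EReal | ∃ k n : ℕ, 0 < k ∧ 0 < n ∧ r = (((k : ℝ) / (n : ℝ) : ℝ) : EReal) ∧
    ∃ (A : Type) (_ : Finite A) (_ : Nontrivial A), N.HasSolution A k n}

/-- The linear capacity with respect to the alphabet `A`, an `R`-module: the supremum of `k / n`
over all `(k, n)` linear solutions over `A`. -/
noncomputable def linearCapacity [DecidableEq V] [Fintype E] [Fintype M] (R A : Type*) [Ring R]
    [AddCommGroup A] [Module R A] : EReal :=
  sSup {r : EReal | ∃ k n : ℕ, 0 < k ∧ 0 < n ∧ r = (((k : ℝ) / (n : ℝ) : ℝ) : EReal) ∧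
    N.HasLinearSolution R A k n}

end Network

/-! ### The network `𝒩₃(m₁, m₂)`

The two blocks are indexed by `l : Fin 2`; block `l` is `B(m l)`, where `m = ![m₁, m₂]`.
Inside it, the indices `0, 1, …, m l` are the elements of `Fin (m l + 1)`. -/

/-- The messages: the shared message `z`, and the messages `x l j` of block `l`, where
`x l j` (with `j : Fin (m l)`) is the message usually numbered `j + 1`. -/
inductive Msg (m : Fin 2 → ℕ) : Type
  | z
  | x (l : Fin 2) (j : Fin (m l))
  deriving DecidableEq, Fintype

/-- The `i`-th message input of block `l`: the shared message for `i = 0`. -/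
def Msg.input {m : Fin 2 → ℕ} (l : Fin 2) (i : Fin (m l + 1)) : Msg m :=
  Fin.cases Msg.z (Msg.x l) i

/-- The nodes: a source `S w` for each message `w`; in block `l` the nodes
`u_0, …, u_m, u`, `v_0, …, v_m, v` and the receivers `R_0, …, R_m`
(the nodes `u` and `v` without index are `uAll` and `vAll`); the additional receiver `Rz`. -/
inductive Node (m : Fin 2 → ℕ) : Type
  | S (w : Msg m)
  | u (l : Fin 2) (i : Fin (m l + 1))
  | uAll (l : Fin 2)
  | v (l : Fin 2) (i : Fin (m l + 1))
  | vAll (l : Fin 2)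
  | R (l : Fin 2) (i : Fin (m l + 1))
  | Rz
  deriving DecidableEq, Fintype

/-- The edges; their end points are listed in `Edge.tail` and `Edge.head`. -/
inductive Edge (m : Fin 2 → ℕ) : Type
  | Su (l : Fin 2) (i : Fin (m l + 1)) (j : {j : Fin (m l + 1) // j ≠ i})
  | SuAll (l : Fin 2) (j : Fin (m l + 1))
  | uv (l : Fin 2) (i : Fin (m l + 1))
  | uvAll (l : Fin 2)
  | vR (l : Fin 2) (i : Fin (m l + 1))
  | vAllR (l : Fin 2) (i : Fin (m l + 1))
  | vRz (l : Fin 2) (i : Fin (m l + 1))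
  deriving DecidableEq, Fintype

def Edge.tail {m : Fin 2 → ℕ} : Edge m → Node m
  | .Su l _ j => .S (Msg.input l j)
  | .SuAll l j => .S (Msg.input l j)
  | .uv l i => .u l i
  | .uvAll l => .uAll l
  | .vR l i => .v l i
  | .vAllR l _ => .vAll l
  | .vRz l i => .v l i

def Edge.head {m : Fin 2 → ℕ} : Edge m → Node m
  | .Su l i _ => .u l i
  | .SuAll l _ => .uAll l
  | .uv l i => .v l i
  | .uvAll l => .vAll l
  | .vR l i => .R l i
  | .vAllR l i => .R l i
  | .vRz _ _ => .Rz

/-- The layer of a node; every edge leads to a higher layer. -/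
def Node.layer {m : Fin 2 → ℕ} : Node m → ℕ
  | .S _ => 0
  | .u _ _ => 1
  | .uAll _ => 1
  | .v _ _ => 2
  | .vAll _ => 2
  | .R _ _ => 3
  | .Rz => 3

theorem Edge.layer_lt {m : Fin 2 → ℕ} (e : Edge m) : e.tail.layer < e.head.layer := by
  cases e <;> simp [Edge.tail, Edge.head, Node.layer]

/-- The network built from the blocks `B(m 0)` and `B(m 1)`: the receiver `R l i` demands the
`i`-th message input of block `l`, and `Rz` demands the shared message `z`. -/
def twoBlocks (m : Fin 2 → ℕ) : Network (Node m) (Edge m) (Msg m) where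
  tail := Edge.tail
  head := Edge.head
  acyclic := by
    have key : ∀ a b : Node m,
        Relation.TransGen (fun a b : Node m => ∃ e : Edge m, e.tail = a ∧ e.head = b) a b →
          a.layer < b.layer := by
      intro a b h
      induction h with
      | single h => obtain ⟨e, rfl, rfl⟩ := h; exact e.layer_lt
      | tail _ h ih => obtain ⟨e, rfl, rfl⟩ := h; exact ih.trans e.layer_lt
    exact fun v h => lt_irrefl _ (key v v h)
  origin := Node.S
  demands
    | .R l i => {Msg.input l i}
    | .Rz => {Msg.z}
    | _ => ∅

/-- The network `𝒩₃(m₁, m₂)`. -/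
abbrev N3 (m₁ m₂ : ℕ) : Network (Node ![m₁, m₂]) (Edge ![m₁, m₂]) (Msg ![m₁, m₂]) :=
  twoBlocks ![m₁, m₂]

end NetworkCoding

/-!
# Capacity and linear capacities of the network `𝒩₃(m₁, m₂)`

Only the vectors `f l i` on `u_i → v_i` and `g l` on `u → v` matter, everything else being
forwarded.  They satisfy three conditions: `f l i` does not depend on the `i`-th input of block `l`;
`f l i` and `g l` together determine this input; all the `f l i` together determine `z`.  In the
linear case these conditions, collected in `IsBlockCode`, are equivalent, for `k ≤ n`, to the existence
of a solution (`exists_isBlockCode_of_hasLinearSolution`, `IsBlockCode.hasLinearSolution`).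

*Capacity at most one.*  If all inputs of a block but one are fixed, then `g l` determines the
remaining one, so `k ≤ n` (`le_of_hasSolution_twoBlocks`).

*The scalar code.*  Let `g l` be the sum of the inputs and `f l i` the sum of all but the `i`-th.
If all `f l i` vanish, then the inputs all equal their sum `s`, hence `m l * s = 0`.  So `z` is
determined as soon as `m l ≠ 0` in the field for one of the two blocks
(`hasLinearSolution_one_one`).  The capacity allows any alphabet, in particular a prime field of
characteristic larger than `m₁`, and is therefore `1`.

*The linear bound when `m₁` and `m₂` vanish in the field.*  Write `δ = n - k` and
`g t = ∑ j, M_j t_j`.  Inputs `t_j` with a common value `s = M_j t_j` make every `f i` almost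
vanish, because `g t = (m + 1) s = s` looks like the contribution of `t_i` alone.  Counting
dimensions, the common values `s` for which all `f i` vanish exactly leave `z` undetermined in a
space of dimension at least `k - (2m + 1) δ` (`exists_submodule_of_block`).  The spaces from the two
blocks intersect trivially, since `z` is decodable; hence `k ≤ (2m₁ + 2m₂ + 2) δ`
(`le_mul_sub_of_hasLinearSolution`).

*The optimal code.*  For `δ = 1` the scalar code is used in each coordinate, but the `j`-th input of
block `l` is placed in a hyperplane `c_j = 0` of the edge space, with different coordinates `c_j`
for different `j`.  In the coordinate `c_i` the vector `f l i` has nothing to contribute to the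
recovery of the `i`-th input, and this free place carries another coordinate of another input.
This lets block `l` determine `2 * m l + 1` coordinates of `z`, and the two blocks together all of
them (`isBlockCode_partialSum`).
-/

namespace NetworkCoding

open Module

/-! ### Linear algebra -/

section LinearAlgebra

variable {F : Type*} [Field F]

theorem exists_comp_eq_of_forall_eq_zero {U V W : Type*} [AddCommGroup U] [Module F U]
    [AddCommGroup V] [Module F V] [AddCommGroup W] [Module F W] (f : U →ₗ[F] V) (g : U →ₗ[F] W)
    (h : ∀ u, f u = 0 → g u = 0) : ∃ q : V →ₗ[F] W, ∀ u, q (f u) = g u := by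
  obtain ⟨q, hq⟩ := LinearMap.exists_extend
    ((LinearMap.ker f).liftQ g (fun u hu => h u hu) ∘ₗ f.quotKerEquivRange.symm.toLinearMap)
  refine ⟨q, fun u => ?_⟩
  have := LinearMap.congr_fun hq (f.quotKerEquivRange (Submodule.Quotient.mk u))
  have hg : (LinearMap.ker f).liftQ g (fun u hu => h u hu) (Submodule.Quotient.mk u) = g u := rfl
  simp only [LinearMap.comp_apply, LinearEquiv.coe_coe, LinearEquiv.symm_apply_apply, hg] at this
  exact this

/-- A bound on the codimension of an intersection that improves on the sum of the codimensions of
the `A j` by the codimensions of the subspaces `T i`, which contain all the `A j` but one.  The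
diagonal map of `E` to `∏ E ⧸ A j` has kernel `⨅ j, A j`, and its range is annihilated by the
surjection `(s_j) ↦ (s_{i + 1} - s_{i + 2})_i` onto `∏ E ⧸ T i`. -/
theorem finrank_iInf_add_sum_quotient_ge {E : Type*} [AddCommGroup E] [Module F E]
    [FiniteDimensional F E] {m : ℕ} (hm : 2 ≤ m) (A T : Fin (m + 1) → Submodule F E)
    (hAT : ∀ i j, j ≠ i → A j ≤ T i) (hsup : ∀ i, A i ⊔ T i = ⊤) :
    finrank F E + ∑ i, finrank F (E ⧸ T i) ≤
      finrank F (⨅ j, A j : Submodule F E) + ∑ j, finrank F (E ⧸ A j) := by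
  -- The cyclic successors `i + 1` and `i + 2` differ from `i` as there are at least
  -- three indices.
  obtain ⟨m, rfl⟩ : ∃ m', m = m' + 2 := ⟨m - 2, by omega⟩
  have h1 : ∀ i : Fin (m + 2 + 1), i + 1 ≠ i := fun i h => by
    have := congrArg Fin.val (add_eq_left.1 h)
    simp at this
  have h2 : ∀ i : Fin (m + 2 + 1), i + 1 + 1 ≠ i := fun i h => by
    have := congrArg Fin.val (add_eq_left.1 ((add_assoc i 1 1).symm.trans h))
    simp [Fin.val_add, Nat.mod_eq_of_lt (show 2 < m + 2 + 1 by omega)] at this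
  let ψ : E →ₗ[F] ∀ j, E ⧸ A j := LinearMap.pi fun j => (A j).mkQ
  let χ : (∀ j, E ⧸ A j) →ₗ[F] ∀ i, E ⧸ T i := LinearMap.pi fun i =>
    Submodule.factor (hAT i _ (h1 i)) ∘ₗ LinearMap.proj (i + 1) -
      Submodule.factor (hAT i _ (h2 i)) ∘ₗ LinearMap.proj (i + 1 + 1)
  have hker : LinearMap.ker ψ = ⨅ j, A j := by
    simp [ψ, LinearMap.ker_pi]
  have hle : LinearMap.range ψ ≤ LinearMap.ker χ := by
    rintro _ ⟨s, rfl⟩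
    ext i
    simp [ψ, χ]
  have hsurj : LinearMap.range χ = ⊤ := by
    refine LinearMap.range_eq_top.2 fun q => ?_
    have hlift : ∀ i, ∃ a ∈ A i, (T i).mkQ a = q i := fun i => by
      obtain ⟨s, hs⟩ := (T i).mkQ_surjective (q i)
      obtain ⟨a, ha, t, ht, rfl⟩ := Submodule.mem_sup.1 (hsup i ▸ Submodule.mem_top : s ∈ A i ⊔ T i)
      refine ⟨a, ha, ?_⟩
      rw [← hs, map_add, (T i).mkQ_apply t, (Submodule.Quotient.mk_eq_zero _).2 ht, add_zero]
    choose a ha haq using hlift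
    -- With `s_j = a_{j - 1}` the difference is `a_i - a_{i + 1}`, and `a_{i + 1}` lies in `T i`.
    refine ⟨fun j => (A j).mkQ (a (j - 1)), funext fun i => ?_⟩
    have : (T i).mkQ (a (i + 1)) = 0 :=
      (Submodule.Quotient.mk_eq_zero _).2 (hAT i _ (h1 i) (ha _))
    rw [Submodule.mkQ_apply] at this
    simp [χ, this, ← haq i]
  have e1 := ψ.finrank_range_add_finrank_ker
  have e2 := χ.finrank_range_add_finrank_ker
  have e3 := Submodule.finrank_mono hle
  rw [hker] at e1
  rw [hsurj, finrank_top, finrank_pi_fintype, finrank_pi_fintype] at e2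
  omega

theorem finrank_le_finrank_map_add {E X : Type*} [AddCommGroup E] [Module F E]
    [FiniteDimensional F E] [AddCommGroup X] [Module F X] [FiniteDimensional F X]
    (D : E →ₗ[F] X) (hD : Function.Surjective D) (T : Submodule F E) :
    finrank F X ≤ finrank F (T.map D) + finrank F (E ⧸ T) := by
  have h1 := (T.map D).finrank_quotient_add_finrank
  have h2 : finrank F (X ⧸ T.map D) ≤ finrank F (E ⧸ T) :=
    LinearMap.finrank_le_finrank_of_surjective (f := T.mapQ (T.map D) D (T.le_comap_map D))
      (by
        rw [← LinearMap.range_eq_top, Submodule.range_mapQ, LinearMap.range_eq_top.2 hD,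
          Submodule.map_top, Submodule.range_mkQ])
  omega

/-- The dimension count for one block whose size vanishes in the field, when the vector `g` takes
all values in `E`: the first input remains undetermined by the `f i` in a space of dimension at
least `k - (2 * m + 1) * (n - k)`. -/
theorem exists_submodule_of_block_aux {m k n : ℕ} (hm : 2 ≤ m) (hmF : (m : F) = 0)
    {X E Y : Type*} [AddCommGroup X] [Module F X] [FiniteDimensional F X]
    [AddCommGroup E] [Module F E] [FiniteDimensional F E]
    [AddCommGroup Y] [Module F Y] [FiniteDimensional F Y]
    (hX : finrank F X = k) (hE : finrank F E ≤ n) (hY : finrank F Y ≤ n)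
    (f : Fin (m + 1) → (Fin (m + 1) → X) →ₗ[F] Y) (g : (Fin (m + 1) → X) →ₗ[F] E)
    (hg : Function.Surjective g)
    (hf : ∀ i t, (∀ j, j ≠ i → t j = 0) → f i t = 0)
    (hfg : ∀ i t, g t = 0 → f i t = 0 → t i = 0) :
    ∃ U : Submodule F X, k ≤ finrank F U + (2 * m + 1) * (n - k) ∧
      ∀ u ∈ U, ∃ t : Fin (m + 1) → X, t 0 = u ∧ ∀ i, f i t = 0 := by
  have hdec : ∀ i, ∃ q : E × Y →ₗ[F] X, ∀ t, q (g t, f i t) = t i := fun i =>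
    exists_comp_eq_of_forall_eq_zero (g.prod (f i)) (LinearMap.proj i) fun t ht =>
      hfg i t (congrArg Prod.fst ht) (congrArg Prod.snd ht)
  choose q hq using hdec
  -- The decoder of the `i`-th input is `t i = D i (g t) + D' i (f i t)`.
  let D : Fin (m + 1) → E →ₗ[F] X := fun i => q i ∘ₗ LinearMap.inl F E Y
  let D' : Fin (m + 1) → Y →ₗ[F] X := fun i => q i ∘ₗ LinearMap.inr F E Y
  have hD : ∀ i t, D i (g t) + D' i (f i t) = t i := fun i t => by
    rw [← hq i t]
    simp [D, D', ← map_add]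
  let M : Fin (m + 1) → X →ₗ[F] E := fun j => g ∘ₗ LinearMap.single F (fun _ => X) j
  have hDM : ∀ i x, D i (M i x) = x := fun i x => by
    have h := hD i (Pi.single i x)
    rw [hf i _ fun j hj => Pi.single_eq_of_ne hj _] at h
    simpa [M] using h
  have hgM : ∀ t, g t = ∑ j, M j (t j) := fun t => by
    conv_lhs => rw [← Finset.univ_sum_single t, map_sum]
    rfl
  -- `A j` consists of the values of `g` on the `j`-th input alone, `T i` of those with `t i = 0`.
  let A : Fin (m + 1) → Submodule F E := fun j => LinearMap.range (M j)
  let T : Fin (m + 1) → Submodule F E := fun i =>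
    (LinearMap.ker (LinearMap.proj (R := F) (φ := fun _ : Fin (m + 1) => X) i)).map g
  have hAT : ∀ i j, j ≠ i → A j ≤ T i := by
    rintro i j hj _ ⟨x, rfl⟩
    exact ⟨Pi.single j x, Pi.single_eq_of_ne hj.symm _, rfl⟩
  have hsup : ∀ i, A i ⊔ T i = ⊤ := fun i => by
    refine eq_top_iff.2 fun s _ => ?_
    obtain ⟨t, rfl⟩ := hg s
    refine Submodule.mem_sup.2 ⟨M i (t i), ⟨_, rfl⟩, g (t - Pi.single i (t i)), ⟨_, ?_, rfl⟩, ?_⟩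
    · simp
    · simp [M]
  have hAdim : ∀ j, finrank F (E ⧸ A j) + k = finrank F E := fun j => by
    rw [← (A j).finrank_quotient_add_finrank,
      LinearMap.finrank_range_of_inj (Function.LeftInverse.injective (hDM j)), hX]
  have hlat := finrank_iInf_add_sum_quotient_ge hm A T hAT hsup
  -- If `t i = 0` then `D' i (f i t) = -D i (g t)`, so the range of `D' i` contains `D i (T i)`.
  have hker : ∀ i, finrank F (LinearMap.ker (D' i)) + k ≤ n + finrank F (E ⧸ T i) := fun i => by
    have h1 := finrank_le_finrank_map_add (D i) (fun x => ⟨_, hDM i x⟩) (T i)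
    have h2 : (T i).map (D i) ≤ LinearMap.range (D' i) := by
      rintro _ ⟨_, ⟨t, ht, rfl⟩, rfl⟩
      refine ⟨-f i t, ?_⟩
      have := hD i t
      rw [show t i = 0 from ht] at this
      rw [map_neg]
      exact (eq_neg_of_add_eq_zero_left this).symm
    have h3 := Submodule.finrank_mono h2
    have h4 := (D' i).finrank_range_add_finrank_ker
    omega
  have hMD : ∀ s ∈ ⨅ j, A j, ∀ j, M j (D j s) = s := fun s hs j => by
    obtain ⟨x, rfl⟩ := (Submodule.mem_iInf _).1 hs j
    rw [hDM]
  -- Take the inputs `D j s` for `s` in all `A j`.  Their image under `g` is `(m + 1) s = s`, so the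
  -- decoder of the `i`-th input forces `f i` into the kernel of `D' i`.
  let G : Fin (m + 1) → E →ₗ[F] Y := fun i => f i ∘ₗ LinearMap.pi D
  have hG : ∀ i, ∀ s ∈ ⨅ j, A j, G i s ∈ LinearMap.ker (D' i) := fun i s hs => by
    have h := hD i (fun j => D j s)
    rw [hgM, Finset.sum_congr rfl fun j _ => hMD s hs j, Finset.sum_const, Finset.card_univ,
      Fintype.card_fin, succ_nsmul, ← Nat.cast_smul_eq_nsmul F, hmF, zero_smul, zero_add] at h
    exact add_eq_left.1 h
  let Φ : (⨅ j, A j : Submodule F E) →ₗ[F] ∀ i, LinearMap.ker (D' i) :=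
    LinearMap.pi fun i => ((G i).domRestrict _).codRestrict _ fun s => hG i s s.2
  -- On `ker Φ` the `f i` vanish, and the first input `D 0 s` determines `s = M 0 (D 0 s)`.
  let ρ : LinearMap.ker Φ →ₗ[F] X := D 0 ∘ₗ Submodule.subtype _ ∘ₗ Submodule.subtype _
  have hρ : Function.Injective ρ := fun s s' h => by
    apply Subtype.ext
    apply Subtype.ext
    rw [← hMD s.1 s.1.2 0, ← hMD s'.1 s'.1.2 0]
    exact congrArg (M 0) h
  refine ⟨LinearMap.range ρ, ?_, ?_⟩
  · rw [LinearMap.finrank_range_of_inj hρ]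
    have hk : k ≤ finrank F E := by have := hAdim 0; omega
    have e1 := Φ.finrank_range_add_finrank_ker
    have e2 : finrank F (LinearMap.range Φ) ≤ ∑ i, finrank F (LinearMap.ker (D' i)) :=
      (Submodule.finrank_le _).trans_eq (finrank_pi_fintype F)
    have e3 := Finset.sum_le_sum fun i (_ : i ∈ Finset.univ) => hker i
    have e4 := Finset.sum_congr rfl fun i (_ : i ∈ Finset.univ) => hAdim i
    simp only [Finset.sum_add_distrib, Finset.sum_const, Finset.card_univ, Fintype.card_fin,
      smul_eq_mul] at e3 e4
    obtain ⟨d, rfl⟩ := Nat.exists_eq_add_of_le (hk.trans hE)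
    rw [Nat.add_sub_cancel_left]
    nlinarith [Nat.mul_le_mul_left m hE]
  · rintro _ ⟨s, rfl⟩
    refine ⟨fun j => D j s, rfl, fun i => ?_⟩
    exact congrArg Subtype.val (congrFun (LinearMap.mem_ker.1 s.2) i)

/-- The first input of a block whose size vanishes in the field remains undetermined by the `f i`
in a space of dimension at least `k - (2 * m + 1) * (n - k)`. -/
theorem exists_submodule_of_block {m k n : ℕ} (hm : 2 ≤ m) (hmF : (m : F) = 0)
    {X Y : Type*} [AddCommGroup X] [Module F X] [FiniteDimensional F X]
    [AddCommGroup Y] [Module F Y] [FiniteDimensional F Y]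
    (hX : finrank F X = k) (hY : finrank F Y ≤ n)
    (f : Fin (m + 1) → (Fin (m + 1) → X) →ₗ[F] Y) (g : (Fin (m + 1) → X) →ₗ[F] Y)
    (hf : ∀ i t, (∀ j, j ≠ i → t j = 0) → f i t = 0)
    (hfg : ∀ i t, g t = 0 → f i t = 0 → t i = 0) :
    ∃ U : Submodule F X, k ≤ finrank F U + (2 * m + 1) * (n - k) ∧
      ∀ u ∈ U, ∃ t : Fin (m + 1) → X, t 0 = u ∧ ∀ i, f i t = 0 :=
  exists_submodule_of_block_aux hm hmF hX ((Submodule.finrank_le _).trans hY) hY f g.rangeRestrict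
    g.surjective_rangeRestrict hf fun i t ht => hfg i t (congrArg Subtype.val ht)

end LinearAlgebra

/-! ### Codes as maps from messages to edge vectors -/

namespace Network

variable {V E M : Type} {N : Network V E M}

/-- A solution without reference to edge and decoding functions: `Y x e` is the vector on the
edge `e` when the messages are `x`.  The vector on an edge is determined by the inputs of its tail,
and each demanded message is determined by the inputs of the node that demands it. -/
structure IsSolutionMap (N : Network V E M) {A : Type*} {k n : ℕ}
    (Y : (M → Fin k → A) → E → Fin n → A) : Prop where
  edge : ∀ e x x', N.inputs x (Y x) (N.tail e) = N.inputs x' (Y x') (N.tail e) → Y x e = Y x' e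
  demand : ∀ v, ∀ w ∈ N.demands v, ∀ x x',
    N.inputs x (Y x) v = N.inputs x' (Y x') v → x w = x' w

theorem inputs_congr {A : Type*} {k n : ℕ} {x x' : M → Fin k → A} {y y' : E → Fin n → A} {v : V}
    (hx : ∀ w, N.origin w = v → x w = x' w) (hy : ∀ e, N.head e = v → y e = y' e) :
    N.inputs x y v = N.inputs x' y' v :=
  Prod.ext (funext fun w => hx w w.2) (funext fun e => hy e e.2)

theorem Code.IsSolution.isSolutionMap {A : Type*} {k n : ℕ} {C : N.Code A k n}
    (hC : C.IsSolution) {Y : (M → Fin k → A) → E → Fin n → A} (hY : ∀ x, C.Carries x (Y x)) :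
    N.IsSolutionMap Y where
  edge e x x' h := by rw [hY x e, hY x' e, h]
  demand v w hw x x' h := by
    rw [← hC x _ (hY x) v ⟨w, hw⟩, ← hC x' _ (hY x') v ⟨w, hw⟩, h]

theorem HasSolution.exists_isSolutionMap [Finite E] {A : Type*} {k n : ℕ}
    (h : N.HasSolution A k n) : ∃ Y : (M → Fin k → A) → E → Fin n → A, N.IsSolutionMap Y := by
  obtain ⟨C, hC⟩ := h
  choose Y hY using fun x => (C.existsUnique_carries x).exists
  exact ⟨Y, hC.isSolutionMap hY⟩

section Linear

variable [DecidableEq V] [Fintype E] [Fintype M] {F : Type*} [Field F] {k n d : ℕ}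

/-- Being given by matrices is the same as being a linear map. -/
theorem isLinearFn_iff_exists_linearMap {v : V} (f : N.Inputs F k n v → Fin d → F) :
    IsLinearFn F f ↔ ∃ L : N.Inputs F k n v →ₗ[F] (Fin d → F), ∀ a, L a = f a := by
  classical
  constructor
  · rintro ⟨P, Q, h⟩
    refine ⟨LinearMap.coprod
      (∑ w, (P w).mulVecLin ∘ₗ LinearMap.proj w) (∑ e, (Q e).mulVecLin ∘ₗ LinearMap.proj e),
      fun a => funext fun i => ?_⟩
    simp [h, Matrix.mulVec, dotProduct]
  · rintro ⟨L, h⟩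
    refine ⟨fun w => LinearMap.toMatrix'
        (L ∘ₗ LinearMap.inl F _ _ ∘ₗ LinearMap.single F (fun _ => Fin k → F) w),
      fun e => LinearMap.toMatrix'
        (L ∘ₗ LinearMap.inr F _ _ ∘ₗ LinearMap.single F (fun _ => Fin n → F) e),
      fun a i => ?_⟩
    have ha : a = ∑ w, (Pi.single w (a.1 w), 0) + ∑ e, (0, Pi.single e (a.2 e)) := by
      refine Prod.ext ?_ ?_
      · simp [Prod.fst_sum, Finset.univ_sum_single]
      · simp [Prod.snd_sum, Finset.univ_sum_single]
    have h1 : ∀ {q : ℕ} (T : (Fin q → F) →ₗ[F] (Fin d → F)) (b : Fin q → F),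
        ∑ j, LinearMap.toMatrix' T i j • b j = T b i := fun T b => by
      conv_rhs => rw [← LinearMap.toMatrix'_mulVec T b]
      rfl
    rw [← h]
    simp only [h1]
    conv_lhs => rw [ha, map_add, map_sum, map_sum]
    simp

/-- The inputs of a node as a linear function of the messages, when the vectors on the edges are
a linear function `Y` of them. -/
def inputsLinear (N : Network V E M) (Y : (M → Fin k → F) →ₗ[F] (E → Fin n → F)) (v : V) :
    (M → Fin k → F) →ₗ[F] N.Inputs F k n v where
  toFun x := N.inputs x (Y x) v
  map_add' x x' := by rw [map_add]; rfl
  map_smul' c x := by rw [map_smul]; rfl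

/-- Linear edge and decoding functions can be recovered from a linear solution map, since linear
maps on a subspace extend to the whole space. -/
theorem hasLinearSolution_iff_exists_isSolutionMap :
    N.HasLinearSolution F F k n ↔
      ∃ Y : (M → Fin k → F) →ₗ[F] (E → Fin n → F), N.IsSolutionMap Y := by
  constructor
  · rintro ⟨C, hC, hlin, -⟩
    choose Y hY using fun x => (C.existsUnique_carries x).exists
    choose L hL using fun e => (isLinearFn_iff_exists_linearMap _).1 (hlin e)
    have huniq : ∀ x y, C.Carries x y → Y x = y := fun x y h =>
      (C.existsUnique_carries x).unique (hY x) h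
    refine ⟨⟨⟨Y, fun x x' => huniq _ _ fun e => ?_⟩, fun c x => huniq _ _ fun e => ?_⟩,
      hC.isSolutionMap hY⟩
    · rw [Pi.add_apply, hY x e, hY x' e, ← hL, ← hL, ← hL, ← map_add]
      rfl
    · change c • Y x e = C.edgeFn e (N.inputs (c • x) (c • Y x) (N.tail e))
      rw [hY x e, ← hL, ← hL, ← map_smul]
      rfl
  · rintro ⟨Y, hY⟩
    have hI : ∀ v x, N.inputsLinear Y v x = 0 → N.inputs x (Y x) v = N.inputs 0 (Y 0) v :=
      fun v x h => h.trans (map_zero (N.inputsLinear Y v)).symm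
    have h1 : ∀ e, ∃ L : N.Inputs F k n (N.tail e) →ₗ[F] (Fin n → F),
        ∀ x, L (N.inputs x (Y x) (N.tail e)) = Y x e := fun e =>
      exists_comp_eq_of_forall_eq_zero (N.inputsLinear Y (N.tail e)) (LinearMap.proj e ∘ₗ Y)
        fun x hx => (hY.edge e x 0 (hI _ _ hx)).trans (by simp)
    have h2 : ∀ v (w : N.demands v), ∃ L : N.Inputs F k n v →ₗ[F] (Fin k → F),
        ∀ x, L (N.inputs x (Y x) v) = x w := fun v w =>
      exists_comp_eq_of_forall_eq_zero (N.inputsLinear Y v) (LinearMap.proj w.1)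
        fun x hx => hY.demand v w w.2 x 0 (hI _ _ hx)
    choose L hL using h1
    choose D hD using h2
    let C : N.Code F k n := ⟨fun e => L e, fun v w => D v w⟩
    refine ⟨C, fun x y hy v w => ?_, fun e => ?_, fun v w => ?_⟩
    · rw [(C.existsUnique_carries x).unique hy (fun e => (hL e x).symm : C.Carries x (Y x))]
      exact hD v w x
    · exact (isLinearFn_iff_exists_linearMap _).2 ⟨L e, fun _ => rfl⟩
    · exact (isLinearFn_iff_exists_linearMap _).2 ⟨D v w, fun _ => rfl⟩

end Linear

end Network

/-! ### Solutions of the network in terms of its blocks -/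

/-- For linear maps, it suffices to compare with the zero messages. -/
theorem Network.isSolutionMap_of_forall_eq_zero {V E M : Type} {N : Network V E M}
    {F : Type*} [Field F] {k n : ℕ} (Y : (M → Fin k → F) →ₗ[F] (E → Fin n → F))
    (hedge : ∀ e x, (∀ w, N.origin w = N.tail e → x w = 0) →
      (∀ e', N.head e' = N.tail e → Y x e' = 0) → Y x e = 0)
    (hdemand : ∀ v, ∀ w ∈ N.demands v, ∀ x, (∀ w, N.origin w = v → x w = 0) →
      (∀ e', N.head e' = v → Y x e' = 0) → x w = 0) :
    N.IsSolutionMap Y := by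
  have key : ∀ v x x', N.inputs x (Y x) v = N.inputs x' (Y x') v →
      (∀ w, N.origin w = v → (x - x') w = 0) ∧ ∀ e', N.head e' = v → Y (x - x') e' = 0 :=
    fun v x x' h => ⟨fun w hw => sub_eq_zero.2 (congrFun (congrArg Prod.fst h) ⟨w, hw⟩),
      fun e' he => by
        rw [map_sub]
        exact sub_eq_zero.2 (congrFun (congrArg Prod.snd h) ⟨e', he⟩)⟩
  refine ⟨fun e x x' h => ?_, fun v w hw x x' h => ?_⟩
  · have := hedge e _ (key _ _ _ h).1 (key _ _ _ h).2
    rw [map_sub] at this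
    exact sub_eq_zero.1 this
  · exact sub_eq_zero.1 (hdemand v w hw _ (key _ _ _ h).1 (key _ _ _ h).2)

variable {m : Fin 2 → ℕ}

theorem Msg.input_injective (l : Fin 2) : Function.Injective (Msg.input (m := m) l) := by
  intro i j h
  induction i using Fin.cases <;> induction j using Fin.cases <;> simp_all [Msg.input]

section General

variable {A : Type*} {k n : ℕ} {Y : (Msg m → Fin k → A) → Edge m → Fin n → A}

theorem Network.IsSolutionMap.source_eq (hY : (twoBlocks m).IsSolutionMap Y)
    {x x' : Msg m → Fin k → A}
    (e : Edge m) {w : Msg m} (he : e.tail = .S w) (h : x w = x' w) : Y x e = Y x' e := by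
  refine hY.edge e x x' (Network.inputs_congr (fun w' hw' => ?_) fun e' he' => ?_)
  · obtain rfl := Node.S.inj ((show Node.S w' = e.tail from hw').trans he)
    exact h
  · have := (show e'.head = e.tail from he').trans he
    cases e' <;> cases this

theorem Network.IsSolutionMap.uv_eq (hY : (twoBlocks m).IsSolutionMap Y)
    {x x' : Msg m → Fin k → A}
    (l : Fin 2) (i : Fin (m l + 1))
    (h : ∀ j, j ≠ i → x (.input l j) = x' (.input l j)) : Y x (.uv l i) = Y x' (.uv l i) := by
  refine hY.edge _ x x' (Network.inputs_congr (fun w hw => by cases hw) fun e he => ?_)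
  change e.head = .u l i at he
  cases e <;> cases he
  rename_i j
  exact hY.source_eq _ rfl (h j j.2)

theorem Network.IsSolutionMap.uvAll_eq (hY : (twoBlocks m).IsSolutionMap Y)
    {x x' : Msg m → Fin k → A}
    (l : Fin 2) (h : ∀ j, x (.input l j) = x' (.input l j)) :
    Y x (.uvAll l) = Y x' (.uvAll l) := by
  refine hY.edge _ x x' (Network.inputs_congr (fun w hw => by cases hw) fun e he => ?_)
  change e.head = .uAll l at he
  cases e <;> cases he
  exact hY.source_eq _ rfl (h _)

theorem Network.IsSolutionMap.v_eq (hY : (twoBlocks m).IsSolutionMap Y)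
    {x x' : Msg m → Fin k → A}
    {l : Fin 2} {i : Fin (m l + 1)} (h : Y x (.uv l i) = Y x' (.uv l i))
    (e : Edge m) (he : e.tail = .v l i) : Y x e = Y x' e := by
  refine hY.edge e x x' (Network.inputs_congr (fun w hw => ?_) fun e' he' => ?_)
  · cases (show Node.S w = e.tail from hw).trans he
  · have := (show e'.head = e.tail from he').trans he
    cases e' <;> cases this
    exact h

theorem Network.IsSolutionMap.input_eq (hY : (twoBlocks m).IsSolutionMap Y)
    {x x' : Msg m → Fin k → A}
    (l : Fin 2) (i : Fin (m l + 1)) (hg : Y x (.uvAll l) = Y x' (.uvAll l))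
    (hf : Y x (.uv l i) = Y x' (.uv l i)) : x (.input l i) = x' (.input l i) := by
  refine hY.demand (.R l i) _ rfl x x'
    (Network.inputs_congr (fun w hw => by cases hw) fun e he => ?_)
  change e.head = .R l i at he
  cases e <;> cases he
  · exact hY.v_eq hf _ rfl
  · refine hY.edge _ x x' (Network.inputs_congr (fun w hw => by cases hw) fun e he => ?_)
    change e.head = .vAll l at he
    cases e <;> cases he
    exact hg

theorem Network.IsSolutionMap.z_eq (hY : (twoBlocks m).IsSolutionMap Y)
    {x x' : Msg m → Fin k → A}
    (h : ∀ l i, Y x (.uv l i) = Y x' (.uv l i)) : x .z = x' .z := by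
  refine hY.demand .Rz _ rfl x x'
    (Network.inputs_congr (fun w hw => by cases hw) fun e he => ?_)
  change e.head = .Rz at he
  cases e <;> cases he
  exact hY.v_eq (h _ _) _ rfl

/-- With all inputs but `z` fixed, the vector on `u → v` in the first block determines `z`. -/
theorem le_of_hasSolution_twoBlocks [Finite A] [Nontrivial A]
    (h : (twoBlocks m).HasSolution A k n) : k ≤ n := by
  obtain ⟨Y, hY⟩ := h.exists_isSolutionMap
  obtain ⟨a⟩ := (inferInstance : Nonempty A)
  let X : (Fin k → A) → Msg m → Fin k → A := fun y => Function.update (fun _ _ => a) .z y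
  have hinj : Function.Injective fun y => Y (X y) (.uvAll 0) := fun y y' hyy' => by
    have := hY.input_eq 0 0 hyy' (hY.uv_eq 0 0 fun j hj => by
      have : Msg.input 0 j ≠ (Msg.z : Msg m) := fun h => hj (Msg.input_injective 0 h)
      simp [X, this])
    simpa [X, Msg.input] using this
  have hcard := Nat.card_le_card_of_injective _ hinj
  simp only [Nat.card_fun, Nat.card_eq_fintype_card, Fintype.card_fin] at hcard
  exact (Nat.pow_le_pow_iff_right Finite.one_lt_card).1 hcard

end General

/-- A linear code on the blocks: `f l i` and `g l` are the vectors carried by `u_i → v_i` and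
`u → v` in block `l`, as linear functions of the tuple of message inputs of the block.  Messages
and edge vectors lie in arbitrary modules `K` and `W`. -/
structure IsBlockCode {F K W : Type*} [Field F] [AddCommGroup K] [Module F K]
    [AddCommGroup W] [Module F W]
    (f : ∀ l : Fin 2, Fin (m l + 1) → (Fin (m l + 1) → K) →ₗ[F] W)
    (g : ∀ l : Fin 2, (Fin (m l + 1) → K) →ₗ[F] W) : Prop where
  indep : ∀ l i t, (∀ j, j ≠ i → t j = 0) → f l i t = 0
  decode : ∀ l i t, g l t = 0 → f l i t = 0 → t i = 0
  decode_z : ∀ x : Msg m → K, (∀ l i, f l i (fun j => x (.input l j)) = 0) → x .z = 0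

section Linear

variable {F : Type*} [Field F] {k n : ℕ}

theorem exists_isBlockCode_of_hasLinearSolution (h : (twoBlocks m).HasLinearSolution F F k n) :
    ∃ (f : ∀ l : Fin 2, Fin (m l + 1) → (Fin (m l + 1) → Fin k → F) →ₗ[F] (Fin n → F))
      (g : ∀ l : Fin 2, (Fin (m l + 1) → Fin k → F) →ₗ[F] (Fin n → F)), IsBlockCode f g := by
  obtain ⟨Y, hY⟩ := Network.hasLinearSolution_iff_exists_isSolutionMap.1 h
  let ρ : ∀ l : Fin 2, (Msg m → Fin k → F) →ₗ[F] (Fin (m l + 1) → Fin k → F) := fun l =>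
    LinearMap.funLeft F (Fin k → F) (Msg.input l)
  have hρ : ∀ l, Function.Surjective (ρ l) := fun l =>
    LinearMap.funLeft_surjective_of_injective F _ _ (Msg.input_injective l)
  have hY0 : ∀ e, Y 0 e = 0 := fun e => by rw [map_zero]; rfl
  have hf : ∀ l i, ∃ q : (Fin (m l + 1) → Fin k → F) →ₗ[F] (Fin n → F),
      ∀ x, q (ρ l x) = Y x (.uv l i) := fun l i =>
    exists_comp_eq_of_forall_eq_zero (ρ l) (LinearMap.proj (.uv l i) ∘ₗ Y) fun x hx =>
      (hY.uv_eq l i fun j _ => congrFun hx j).trans (hY0 _)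
  have hg : ∀ l, ∃ q : (Fin (m l + 1) → Fin k → F) →ₗ[F] (Fin n → F),
      ∀ x, q (ρ l x) = Y x (.uvAll l) := fun l =>
    exists_comp_eq_of_forall_eq_zero (ρ l) (LinearMap.proj (.uvAll l) ∘ₗ Y) fun x hx =>
      (hY.uvAll_eq l fun j => congrFun hx j).trans (hY0 _)
  choose f hf using hf
  choose g hg using hg
  refine ⟨f, g, fun l i t ht => ?_, fun l i t hgt hft => ?_, fun x hx => ?_⟩
  · obtain ⟨x, rfl⟩ := hρ l t
    rw [hf, ← hY0 (.uv l i)]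
    exact hY.uv_eq l i ht
  · obtain ⟨x, rfl⟩ := hρ l t
    rw [hf, ← hY0] at hft
    rw [hg, ← hY0] at hgt
    exact hY.input_eq l i hgt hft
  · exact hY.z_eq (x' := 0) fun l i => ((hf l i x).symm.trans (hx l i)).trans (hY0 _).symm

theorem IsBlockCode.hasLinearSolution {K W : Type*} [AddCommGroup K] [Module F K]
    [FiniteDimensional F K] [AddCommGroup W] [Module F W] [FiniteDimensional F W]
    (hK : finrank F K = k) (hW : finrank F W = n) (hkn : k ≤ n)
    {f : ∀ l : Fin 2, Fin (m l + 1) → (Fin (m l + 1) → K) →ₗ[F] W}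
    {g : ∀ l : Fin 2, (Fin (m l + 1) → K) →ₗ[F] W} (h : IsBlockCode f g) :
    (twoBlocks m).HasLinearSolution F F k n := by
  let α : (Fin k → F) ≃ₗ[F] K := LinearEquiv.ofFinrankEq _ _ (by simp [hK])
  let β : W ≃ₗ[F] (Fin n → F) := LinearEquiv.ofFinrankEq _ _ (by simp [hW])
  -- The sources send their messages unchanged, padded with zeros.
  let ι : (Fin k → F) →ₗ[F] (Fin n → F) := Function.ExtendByZero.linearMap F (Fin.castLE hkn)
  have hι : ∀ y, ι y = 0 → y = 0 := fun y hy => funext fun i => by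
    have := congrFun hy (Fin.castLE hkn i)
    rwa [Function.ExtendByZero.linearMap_apply, (Fin.castLE_injective hkn).extend_apply] at this
  let ρ : ∀ l : Fin 2, (Msg m → Fin k → F) →ₗ[F] (Fin (m l + 1) → K) := fun l =>
    LinearMap.pi fun i => α.toLinearMap ∘ₗ LinearMap.proj (Msg.input l i)
  let y : Edge m → (Msg m → Fin k → F) →ₗ[F] (Fin n → F)
    | .Su l _ j => ι ∘ₗ LinearMap.proj (Msg.input l j)
    | .SuAll l j => ι ∘ₗ LinearMap.proj (Msg.input l j)
    | .uv l i | .vR l i | .vRz l i => β.toLinearMap ∘ₗ f l i ∘ₗ ρ l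
    | .uvAll l | .vAllR l _ => β.toLinearMap ∘ₗ g l ∘ₗ ρ l
  have hf : ∀ l i x, β (f l i (ρ l x)) = 0 → f l i (ρ l x) = 0 := fun l i x => by simp
  have hg : ∀ l x, β (g l (ρ l x)) = 0 → g l (ρ l x) = 0 := fun l x => by simp
  refine Network.hasLinearSolution_iff_exists_isSolutionMap.2 ⟨LinearMap.pi y,
    Network.isSolutionMap_of_forall_eq_zero _ (fun e x hx hy => ?_) fun v w hw x hx hy => ?_⟩
  · cases e with
    | Su l i j => exact (congrArg ι (hx _ rfl)).trans (map_zero ι)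
    | SuAll l j => exact (congrArg ι (hx _ rfl)).trans (map_zero ι)
    | uv l i =>
      have : f l i (ρ l x) = 0 := h.indep l i _ fun j hj =>
        (congrArg α (hι _ (hy (.Su l i ⟨j, hj⟩) rfl))).trans (map_zero α)
      exact (congrArg β this).trans (map_zero β)
    | uvAll l =>
      have : ρ l x = 0 := funext fun j =>
        (congrArg α (hι _ (hy (.SuAll l j) rfl))).trans (map_zero α)
      exact (congrArg (fun t => β (g l t)) this).trans (by simp)
    | vR l i => exact hy (.uv l i) rfl
    | vAllR l i => exact hy (.uvAll l) rfl
    | vRz l i => exact hy (.uv l i) rfl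
  · cases v with
    | R l i =>
      obtain rfl : w = Msg.input l i := hw
      have := h.decode l i (ρ l x) (hg _ _ (hy (.vAllR l i) rfl)) (hf _ _ _ (hy (.vR l i) rfl))
      exact α.map_eq_zero_iff.1 this
    | Rz =>
      obtain rfl : w = Msg.z := hw
      have := h.decode_z (fun w => α (x w)) fun l i => hf _ _ _ (hy (.vRz l i) rfl)
      exact α.map_eq_zero_iff.1 this
    | _ => cases hw

end Linear

variable {m : Fin 2 → ℕ} {F : Type*} [Field F]

/-! ### The scalar code for coprime characteristic -/

theorem hasLinearSolution_one_one {l : Fin 2} (hl : (m l : F) ≠ 0) :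
    (twoBlocks m).HasLinearSolution F F 1 1 := by
  refine IsBlockCode.hasLinearSolution (K := F) (W := F) (finrank_self F) (finrank_self F) le_rfl
    (f := fun l i => ∑ j, LinearMap.proj j - LinearMap.proj i)
    (g := fun l => ∑ j, LinearMap.proj j)
    ⟨fun l i t ht => ?_, fun l i t hg hf => ?_, fun x hx => ?_⟩
  · simp [Finset.sum_eq_single i (fun j _ hj => ht j hj)]
  · simp only [LinearMap.sub_apply, hg, zero_sub, LinearMap.proj_apply, neg_eq_zero] at hf
    exact hf
  · -- Every input equals the sum of all inputs, which is thus annihilated by `m l`.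
    have h1 : ∀ i, x (Msg.input l i) = ∑ j, x (Msg.input l j) := fun i =>
      (sub_eq_zero.1 (by simpa using hx l i)).symm
    have h2 : ∑ j, x (Msg.input l j) = (m l + 1) * ∑ j, x (Msg.input l j) := by
      conv_lhs => rw [Finset.sum_congr rfl fun j _ => h1 j]
      simp
    have h3 : (m l : F) * ∑ j, x (Msg.input l j) = 0 := by linear_combination -h2
    exact (h1 0).trans ((mul_eq_zero.1 h3).resolve_left hl)

/-! ### The optimal code when the characteristic divides both block sizes -/

/-- The coordinates of a message vector in the optimal code: block `l` contributes one coordinate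
for each of its own messages and one for each of its message inputs. -/
abbrev Coord (m : Fin 2 → ℕ) : Type := Σ l : Fin 2, Fin (m l) ⊕ Fin (m l + 1)

/-- The coordinate of an edge vector at which the `j`-th summand of block `l` is zero. -/
def missing (l : Fin 2) (j : Fin (m l + 1)) : Option (Coord m) :=
  Fin.cases none (fun r => some ⟨l, .inl r⟩) j

theorem missing_injective (l : Fin 2) : Function.Injective (missing (m := m) l) := by
  intro i j h
  induction i using Fin.cases <;> induction j using Fin.cases <;> simp_all [missing]

theorem missing_ne (l : Fin 2) (i j : Fin (m l + 1)) :
    missing l j ≠ some (⟨l, .inr i⟩ : Coord m) := by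
  induction j using Fin.cases <;> simp [missing]

/-- A message vector, spread over the coordinates of an edge vector other than `missing l j`:
the additional coordinate `none` is filled with zero and then exchanged with `missing l j`. -/
def spread (l : Fin 2) (j : Fin (m l + 1)) : (Coord m → F) →ₗ[F] (Option (Coord m) → F) :=
  LinearMap.pi fun c => (Equiv.swap none (missing l j) c).elim 0 LinearMap.proj

theorem spread_missing (l : Fin 2) (j : Fin (m l + 1)) (x : Coord m → F) :
    spread l j x (missing l j) = 0 := by
  simp [spread]

theorem spread_zero_some (l : Fin 2) (x : Coord m → F) (c : Coord m) :
    spread l 0 x (some c) = x c := by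
  simp [spread, missing]

theorem eq_zero_of_spread_eq_zero {l : Fin 2} {j : Fin (m l + 1)} {x : Coord m → F}
    (h : spread l j x = 0) : x = 0 := by
  funext c
  have := congrFun h (Equiv.swap none (missing l j) (some c))
  simpa [spread] using this

/-- The vector on `u → v` in block `l`: the sum of all message inputs, each spread over the
coordinates. -/
def totalSum (l : Fin 2) : (Fin (m l + 1) → Coord m → F) →ₗ[F] (Option (Coord m) → F) :=
  ∑ j, spread l j ∘ₗ LinearMap.proj j

/-- The vector on `u_i → v_i` in block `l`: the sum of the message inputs other than the `i`-th,
except that the coordinate `missing l i`, useless for recovering the `i`-th input, instead carries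
one coordinate of the next input. -/
def partialSum (l : Fin 2) (i : Fin (m l + 1)) :
    (Fin (m l + 1) → Coord m → F) →ₗ[F] (Option (Coord m) → F) :=
  LinearMap.pi fun c =>
    if c = missing l i then LinearMap.proj (some ⟨l, .inr i⟩) ∘ₗ spread l (i + 1) ∘ₗ
      LinearMap.proj (i + 1)
    else LinearMap.proj c ∘ₗ (totalSum l - spread l i ∘ₗ LinearMap.proj i)

theorem totalSum_apply (l : Fin 2) (t : Fin (m l + 1) → Coord m → F) (c : Option (Coord m)) :
    totalSum l t c = ∑ j, spread l j (t j) c := by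
  simp [totalSum]

theorem partialSum_missing (l : Fin 2) (i : Fin (m l + 1)) (t : Fin (m l + 1) → Coord m → F) :
    partialSum l i t (missing l i) = spread l (i + 1) (t (i + 1)) (some ⟨l, .inr i⟩) := by
  simp [partialSum]

theorem partialSum_of_ne {l : Fin 2} {i : Fin (m l + 1)} (t : Fin (m l + 1) → Coord m → F)
    {c : Option (Coord m)} (hc : c ≠ missing l i) :
    partialSum l i t c = totalSum l t c - spread l i (t i) c := by
  simp [partialSum, hc]

theorem isBlockCode_partialSum (hm : ∀ l, 1 ≤ m l) (hmF : ∀ l, (m l : F) = 0) :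
    IsBlockCode (F := F) (partialSum (m := m)) totalSum where
  indep l i t ht := by
    funext c
    by_cases hc : c = missing l i
    · have hi : i + 1 ≠ i := fun h => by
        have h1 := Fin.one_eq_zero_iff.1 (add_eq_left.1 h)
        have h2 := hm l
        omega
      rw [hc, partialSum_missing, ht _ hi, map_zero]
      rfl
    · rw [partialSum_of_ne t hc, totalSum_apply, Finset.sum_eq_single i
        (fun j _ hj => by rw [ht j hj, map_zero]; rfl) (by simp), sub_self]
      rfl
  decode l i t hg hf := by
    refine eq_zero_of_spread_eq_zero (l := l) (j := i) (funext fun c => ?_)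
    by_cases hc : c = missing l i
    · rw [hc, spread_missing]
      rfl
    · have := congrFun hf c
      rw [partialSum_of_ne t hc, hg] at this
      simpa using this
  decode_z x hx := by
    funext ⟨l, d⟩
    change x .z ⟨l, d⟩ = 0
    rw [← spread_zero_some l (x .z)]
    set t : Fin (m l + 1) → Coord m → F := fun j => x (Msg.input l j) with ht
    change spread l 0 (t 0) _ = 0
    have heq : ∀ i c, c ≠ missing l i → spread l i (t i) c = totalSum l t c := fun i c hc => by
      have := congrFun (hx l i) c
      rw [partialSum_of_ne _ hc] at this
      exact (sub_eq_zero.1 this).symm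
    cases d with
    | inl r =>
      -- In the coordinate missing for `r + 1`, the other `m l` summands all equal the total.
      have h1 := totalSum_apply l t (missing l r.succ)
      rw [Fin.sum_univ_succAbove _ r.succ, spread_missing, zero_add, Finset.sum_congr rfl
        fun j _ => heq (r.succ.succAbove j) _
          ((missing_injective l).ne (Fin.succAbove_ne _ _).symm)] at h1
      simp only [Finset.sum_const, Finset.card_univ, Fintype.card_fin, nsmul_eq_mul, hmF,
        zero_mul] at h1
      exact (heq 0 _ ((missing_injective l).ne (Fin.succ_ne_zero r))).trans h1
    | inr i =>
      -- All summands agree in this coordinate, and the free place of `f l i` carries one of them.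
      rw [heq 0 _ (missing_ne l i 0).symm, ← heq (i + 1) _ (missing_ne l i (i + 1)).symm,
        ← partialSum_missing]
      exact congrFun (hx l i) _

theorem card_coord : Fintype.card (Coord m) = 2 * m 0 + 2 * m 1 + 2 := by
  simp [Fintype.card_sigma]
  omega

theorem hasLinearSolution_of_cast_eq_zero (hm : ∀ l, 1 ≤ m l) (hmF : ∀ l, (m l : F) = 0) :
    (twoBlocks m).HasLinearSolution F F (2 * m 0 + 2 * m 1 + 2) (2 * m 0 + 2 * m 1 + 3) :=
  (isBlockCode_partialSum hm hmF).hasLinearSolution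
    (by rw [finrank_fintype_fun_eq_card, card_coord])
    (by rw [finrank_fintype_fun_eq_card, Fintype.card_option, card_coord]) (Nat.le_succ _)

/-! ### The bound on linear solutions -/

theorem le_mul_sub_of_hasLinearSolution {k n : ℕ} (hm : ∀ l, 2 ≤ m l) (hmF : ∀ l, (m l : F) = 0)
    (h : (twoBlocks m).HasLinearSolution F F k n) :
    k ≤ (2 * m 0 + 2 * m 1 + 2) * (n - k) := by
  obtain ⟨f, g, hfg⟩ := exists_isBlockCode_of_hasLinearSolution h
  have hU := fun l => exists_submodule_of_block (hm l) (hmF l) (finrank_fin_fun F)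
    (finrank_fin_fun F).le (f l) (g l) (hfg.indep l) (hfg.decode l)
  choose U hUk hU using hU
  have hinf : U 0 ⊓ U 1 = ⊥ := by
    refine (Submodule.eq_bot_iff _).2 fun z hz => ?_
    have hz' : ∀ l, z ∈ U l := Fin.forall_fin_two.2 hz
    choose t ht0 ht using fun l => hU l z (hz' l)
    let x : Msg m → Fin k → F
      | .z => z
      | .x l j => t l j.succ
    have hx : ∀ l, (fun j => x (Msg.input l j)) = t l := fun l => funext fun j => by
      induction j using Fin.cases with
      | zero => exact (ht0 l).symm
      | succ j => rfl
    exact hfg.decode_z x fun l i => by rw [hx, ht]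
  have h1 := Submodule.finrank_sup_add_finrank_inf_eq (U 0) (U 1)
  have h2 := (U 0 ⊔ U 1).finrank_le
  rw [hinf, finrank_bot] at h1
  rw [finrank_fin_fun] at h2
  have h3 := hUk 0
  have h4 := hUk 1
  nlinarith

/-! ### Capacities -/

theorem linearCapacity_le_one [Finite F] : (twoBlocks m).linearCapacity F F ≤ 1 := by
  refine sSup_le ?_
  rintro _ ⟨k, n, -, hn, rfl, C, hC, -⟩
  have : k ≤ n := le_of_hasSolution_twoBlocks ⟨C, hC⟩
  exact_mod_cast div_le_one_of_le₀ (Nat.cast_le.2 this) (Nat.cast_nonneg (α := ℝ) n)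

theorem linearCapacity_eq_one [Finite F] {l : Fin 2} (hl : (m l : F) ≠ 0) :
    (twoBlocks m).linearCapacity F F = 1 :=
  linearCapacity_le_one.antisymm
    (le_sSup ⟨1, 1, one_pos, one_pos, by simp, hasLinearSolution_one_one hl⟩)

theorem capacity_eq_one (hm : 1 ≤ m 0) : (twoBlocks m).capacity = 1 := by
  refine le_antisymm (sSup_le ?_) ?_
  · rintro _ ⟨k, n, -, hn, rfl, A, _, _, h⟩
    have : k ≤ n := le_of_hasSolution_twoBlocks h
    exact_mod_cast div_le_one_of_le₀ (Nat.cast_le.2 this) (Nat.cast_nonneg (α := ℝ) n)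
  · obtain ⟨p, hmp, hp⟩ := Nat.exists_infinite_primes (m 0 + 1)
    have : Fact p.Prime := ⟨hp⟩
    have h0 : (m 0 : ZMod p) ≠ 0 := fun h =>
      Nat.not_dvd_of_pos_of_lt hm hmp ((ZMod.natCast_eq_zero_iff _ _).1 h)
    obtain ⟨C, hC, -⟩ := hasLinearSolution_one_one h0
    exact le_sSup ⟨1, 1, one_pos, one_pos, by simp, ZMod p, inferInstance, inferInstance, C, hC⟩

theorem linearCapacity_eq_of_cast_eq_zero [Finite F] (hm : ∀ l, 2 ≤ m l)
    (hmF : ∀ l, (m l : F) = 0) :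
    (twoBlocks m).linearCapacity F F =
      ((1 - 1 / (2 * (m 0 : ℝ) + 2 * (m 1 : ℝ) + 3) : ℝ) : EReal) := by
  have hpos : (0 : ℝ) < 2 * (m 0 : ℝ) + 2 * (m 1 : ℝ) + 3 := by positivity
  refine le_antisymm (sSup_le ?_) (le_sSup ?_)
  · rintro _ ⟨k, n, -, hn, rfl, h⟩
    have hle := le_mul_sub_of_hasLinearSolution hm hmF h
    obtain ⟨C, hC, -⟩ := h
    have hkn : k ≤ n := le_of_hasSolution_twoBlocks ⟨C, hC⟩
    have hle' : (k : ℝ) ≤ (2 * m 0 + 2 * m 1 + 2) * (n - k) := by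
      rw [← Nat.cast_sub hkn]
      exact_mod_cast hle
    have hn' : (0 : ℝ) < n := Nat.cast_pos.2 hn
    rw [EReal.coe_le_coe_iff, one_sub_div hpos.ne', div_le_div_iff₀ hn' hpos]
    linarith
  · refine ⟨2 * m 0 + 2 * m 1 + 2, 2 * m 0 + 2 * m 1 + 3, by positivity, by positivity, ?_,
      hasLinearSolution_of_cast_eq_zero (fun l => (hm l).trans' one_le_two) hmF⟩
    congr 1
    push_cast
    field_simp
    ring

end NetworkCoding

theorem lemma4p9 (m₁ m₂ : ℕ) (hm₁ : 2 ≤ m₁) (hm₂ : 2 ≤ m₂) :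
    (NetworkCoding.N3 m₁ m₂).capacity = 1 ∧
    (∀ (F : Type*) [Field F] [Finite F],
      (ringChar F).Coprime m₁ ∨ (ringChar F).Coprime m₂ →
        (NetworkCoding.N3 m₁ m₂).linearCapacity F F = 1) ∧
    (∀ (F : Type*) [Field F] [Finite F],
      ringChar F ∣ m₁ → ringChar F ∣ m₂ →
        (NetworkCoding.N3 m₁ m₂).linearCapacity F F =
            ((1 - 1 / (2 * (m₁ : ℝ) + 2 * (m₂ : ℝ) + 3) : ℝ) : EReal) ∧
          (NetworkCoding.N3 m₁ m₂).HasLinearSolution F F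
            (2 * m₁ + 2 * m₂ + 2) (2 * m₁ + 2 * m₂ + 3)) := by
  have hm : ∀ l, 2 ≤ ![m₁, m₂] l := Fin.forall_fin_two.2 ⟨hm₁, hm₂⟩
  refine ⟨NetworkCoding.capacity_eq_one ((hm 0).trans' one_le_two), fun F _ _ h => ?_,
    fun F _ _ h₁ h₂ => ?_⟩
  · have hne : ∀ r : ℕ, (ringChar F).Coprime r → (r : F) ≠ 0 := fun r hr h0 =>
      CharP.ringChar_ne_one (hr.eq_one_of_dvd ((ringChar.spec F r).1 h0))
    exact h.elim (fun h => NetworkCoding.linearCapacity_eq_one (l := 0) (hne m₁ h))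
      fun h => NetworkCoding.linearCapacity_eq_one (l := 1) (hne m₂ h)
  · have hmF : ∀ l, (![m₁, m₂] l : F) = 0 :=
      Fin.forall_fin_two.2 ⟨(ringChar.spec F m₁).2 h₁, (ringChar.spec F m₂).2 h₂⟩
    exact ⟨NetworkCoding.linearCapacity_eq_of_cast_eq_zero hm hmF,
      NetworkCoding.hasLinearSolution_of_cast_eq_zero (fun l => (hm l).trans' one_le_two) hmF⟩
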